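/- An mm-space is a complete separable metric space $(X,d_X)$ with a Borel probability measure $\mu_X$. Two mm-spaces $X,Y$ are mm-isomorphic if there is an isometry from $\operatorname{supp}\mu_X$ onto $\operatorname{supp}\mu_Y$ pushing $\mu_X$ forward to $\mu_Y$; let $\mathcal X$ be the set of mm-isomorphism classes. Write $Y\succ X$ if there is a $1$-Lipschitz map $F:Y\to X$ with $F_*\mu_Y=\mu_X$. Let $\mathrm{Lip}_1(X)$ be the set of $1$-Lipschitz functions $X\to\mathbb R$. Let $n\in\{1,2,\dots\}\cup\{\infty\}$, $\mathbb N_n=\{i\in\mathbb N: 1\le i\le n\}$, and let $\boldsymbol\alpha=(\alpha_i)_{i\in\mathbb N_n}$ be a family of positive real numbers. For an mm-space $X$ put $$\operatorname{diam}(X;\boldsymbol\alpha)=\inf\Big\{\sup_{i\in\mathbb N_n}\operatorname{diam}A_i\Big\}\in[0,\infty],$$ where the infimum is over all families $(A_i)_{i\in\mathbb N_n}$ of pairwise disjoint Borel subsets of $X$ with $\mu_X(A_i)\ge\alpha_i$ for all $i$ (and is $\infty$ if there is no such family). The $\boldsymbol\alpha$-partial diameter and the $\boldsymbol\alpha$-observable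 diameter of $X$ are $$\underline{\operatorname{diam}}(X;\boldsymbol\alpha)=\inf_{Y\succ X}\operatorname{diam}(Y;\boldsymbol\alpha),\qquad \underline{\operatorname{ObsDiam}}(X;\boldsymbol\alpha)=\sup_{f\in\mathrm{Lip}_1(X)}\underline{\operatorname{diam}}\big((\mathbb R,|\cdot|,f_*\mu_X);\boldsymbol\alpha\big);$$ both depend only on the mm-isomorphism class of $X$. A parameter of $X$ is a Borel map $\varphi:[0,1)\to X$ with $\varphi_*\mathcal L^1=\mu_X$, where $\mathcal L^1$ is Lebesgue measure. The observable distance of $X$ and $Y$ is $$d_{\mathrm{conc}}(X,Y)=\inf_{\varphi,\psi}d_H\big(\{f\circ\varphi: f\in\mathrm{Lip}_1(X)\},\{g\circ\psi: g\in\mathrm{Lip}_1(Y)\}\big),$$ where $\varphi,\psi$ run over the parameters of $X$ and $Y$, and $d_H$ is the Hausdorff distance with respect to the Ky Fan metric $d_{KF}(f,g)=\inf\{\varepsilon\ge0:\mathcal L^1(|f-g|>\varepsilon)\le\varepsilon\}$. The topology on $\mathcal X$ induced by $d_{\mathrm{conc}}$ is called the concentration topology. Corollary. For every such $\boldsymbol\alpha$,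 the functions $\underline{\operatorname{diam}}(\,\cdot\,;\boldsymbol\alpha)$ and $\underline{\operatorname{ObsDiam}}(\,\cdot\,;\boldsymbol\alpha)$ from $\mathcal X$ to $[0,\infty]$ are lower semicontinuous with respect to the concentration topology. -/

import Mathlib

open MeasureTheory Set
open scoped ENNReal NNReal

universe u

noncomputable section

/-- An mm-space: a complete separable metric space with a Borel probability measure. -/
structure MMSpace : Type (u + 1) where
  carrier : Type u
  [metric : MetricSpace carrier]
  [complete : CompleteSpace carrier]
  [separable : TopologicalSpace.SeparableSpace carrier]
  [measurable : MeasurableSpace carrier]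
  [borel : BorelSpace carrier]
  μ : Measure carrier
  [prob : IsProbabilityMeasure μ]

namespace MMSpace

instance : CoeSort MMSpace.{u} (Type u) := ⟨carrier⟩

attribute [instance] metric complete separable measurable borel prob

instance (X : MMSpace.{u}) : SecondCountableTopology X :=
  UniformSpace.secondCountable_of_separable X

/-- Two mm-spaces are mm-isomorphic if there is an isometry between the supports of their measures
which pushes the one measure (regarded as a measure on its support) forward to the other. -/
def MMIso (X Y : MMSpace.{u}) : Prop :=
  ∃ e : X.μ.support ≃ᵢ Y.μ.support,
    (X.μ.comap Subtype.val).map e = Y.μ.comap Subtype.val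

/-- `X.Dominates Y` is the Lipschitz order `X ≻ Y`. -/
def Dominates (X Y : MMSpace.{u}) : Prop :=
  ∃ F : X → Y, LipschitzWith 1 F ∧ X.μ.map F = Y.μ

/-- The mm-space `(ℝ, f_* μ_X)` for a `1`-Lipschitz function `f` on `X`. -/
def pushReal (X : MMSpace.{u}) (f : X → ℝ) (hf : LipschitzWith 1 f) : MMSpace.{0} :=
  haveI : IsProbabilityMeasure (X.μ.map f) :=
    Measure.isProbabilityMeasure_map hf.continuous.measurable.aemeasurable
  { carrier := ℝ, μ := X.μ.map f }

end MMSpace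

/-- The set `ℕ_n = ℕ ∩ [1, n]` for `n ∈ ℕ ∪ {∞}`. -/
def NatUpTo (n : ℕ∞) : Set ℕ := {i | 1 ≤ i ∧ (i : ℕ∞) ≤ n}

/-- Finite or infinite sequences of positive real numbers, of length `n ∈ {1, 2, …} ∪ {∞}`. -/
structure MultiIndex where
  n : ℕ∞
  one_le : 1 ≤ n
  val : NatUpTo n → ℝ
  pos : ∀ i, 0 < val i

namespace MMSpace

/-- The set `D_X(α)` of families of disjoint Borel sets `A_i` with `μ_X(A_i) ≥ α_i`. -/
def families (X : MMSpace.{u}) (α : MultiIndex) : Set (NatUpTo α.n → Set X) :=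
  {A | (∀ i, MeasurableSet (A i)) ∧ Pairwise (fun i j => Disjoint (A i) (A j)) ∧
    ∀ i, ENNReal.ofReal (α.val i) ≤ X.μ (A i)}

/-- `diam(X; α)`; it is `∞` if `D_X(α)` is empty. -/
def diam (X : MMSpace.{u}) (α : MultiIndex) : ℝ≥0∞ :=
  ⨅ A ∈ X.families α, ⨆ i, Metric.ediam (A i)

/-- The `α`-partial diameter: the infimum of `diam(Y; α)` over all mm-spaces `Y ≻ X`. -/
def partialDiam (X : MMSpace.{u}) (α : MultiIndex) : ℝ≥0∞ :=
  ⨅ (Y : MMSpace.{u}) (_ : Y.Dominates X), Y.diam α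

/-- The `α`-observable diameter: the supremum of the `α`-partial diameters of `(ℝ, f_* μ_X)` over
all `1`-Lipschitz functions `f` on `X`. -/
def obsDiam (X : MMSpace.{u}) (α : MultiIndex) : ℝ≥0∞ :=
  ⨆ (f : X → ℝ) (hf : LipschitzWith 1 f), (X.pushReal f hf).partialDiam α

/-- Lebesgue measure on `[0,1)`. -/
def lebesgueI : Measure (Ico (0 : ℝ) 1) := (volume : Measure ℝ).comap Subtype.val

/-- A parameter of `X`: a Borel map `[0,1) → X` that pushes Lebesgue measure forward to `μ_X`. -/
def IsParameter (X : MMSpace.{u}) (φ : Ico (0 : ℝ) 1 → X) : Prop :=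
  Measurable φ ∧ lebesgueI.map φ = X.μ

/-- The pull-back `φ^* Lip_1(X)`. -/
def pullLip (X : MMSpace.{u}) (φ : Ico (0 : ℝ) 1 → X) : Set (Ico (0 : ℝ) 1 → ℝ) :=
  {h | ∃ f : X → ℝ, LipschitzWith 1 f ∧ h = f ∘ φ}

end MMSpace

/-- The Ky Fan distance of two real functions on a measure space. -/
def kyFan {Ω : Type*} [MeasurableSpace Ω] (μ : Measure Ω) (f g : Ω → ℝ) : ℝ≥0∞ :=
  ⨅ (ε : ℝ≥0) (_ : μ {x | (ε : ℝ) < |f x - g x|} ≤ ε), (ε : ℝ≥0∞)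

/-- The Hausdorff distance of two sets of functions with respect to the Ky Fan distance. -/
def kyFanHausdorff {Ω : Type*} [MeasurableSpace Ω] (μ : Measure Ω) (S T : Set (Ω → ℝ)) : ℝ≥0∞ :=
  (⨆ f ∈ S, ⨅ g ∈ T, kyFan μ f g) ⊔ ⨆ g ∈ T, ⨅ f ∈ S, kyFan μ g f

namespace MMSpace

/-- The observable distance. -/
def obsDist (X Y : MMSpace.{u}) : ℝ≥0∞ :=
  ⨅ (φ : Ico (0 : ℝ) 1 → X) (_ : X.IsParameter φ)
    (ψ : Ico (0 : ℝ) 1 → Y) (_ : Y.IsParameter ψ),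
    kyFanHausdorff lebesgueI (X.pullLip φ) (Y.pullLip ψ)

/-! The notions above are invariant under mm-isomorphism. -/

theorem MMIso.refl (X : MMSpace.{u}) : MMIso X X :=
  ⟨IsometryEquiv.refl _, Measure.map_id⟩

theorem MMIso.symm {X Y : MMSpace.{u}} : MMIso X Y → MMIso Y X := by
  rintro ⟨e, he⟩
  refine ⟨e.symm, ?_⟩
  rw [← he, Measure.map_map e.symm.continuous.measurable e.continuous.measurable]
  have : (e.symm ∘ e : X.μ.support → X.μ.support) = id := funext e.symm_apply_apply
  rw [this, Measure.map_id]

theorem MMIso.trans {X Y Z : MMSpace.{u}} : MMIso X Y → MMIso Y Z → MMIso X Z := by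
  rintro ⟨e, he⟩ ⟨e', he'⟩
  refine ⟨e.trans e', ?_⟩
  rw [← he', ← he, Measure.map_map e'.continuous.measurable e.continuous.measurable]
  rfl

/-- An mm-isomorphism and its inverse, extended to measurable maps of the whole spaces. -/
theorem MMIso.exists_maps {X Y : MMSpace.{u}} (h : MMIso X Y) :
    ∃ (T : X → Y) (T' : Y → X), Measurable T ∧ X.μ.map T = Y.μ ∧
      (∀ x ∈ X.μ.support, T x ∈ Y.μ.support ∧ T' (T x) = x) ∧
      (∀ x ∈ X.μ.support, ∀ y ∈ X.μ.support, edist (T x) (T y) = edist x y) ∧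
      (∀ x ∈ Y.μ.support, ∀ y ∈ Y.μ.support, edist (T' x) (T' y) = edist x y) := by
  classical
  obtain ⟨e, he⟩ := h
  have mX : MeasurableSet X.μ.support := Measure.isClosed_support.measurableSet
  have mY : MeasurableSet Y.μ.support := Measure.isClosed_support.measurableSet
  obtain ⟨x₀⟩ := nonempty_of_isProbabilityMeasure X.μ
  obtain ⟨y₀⟩ := nonempty_of_isProbabilityMeasure Y.μ
  let T : X → Y := fun x => if h : x ∈ X.μ.support then (e ⟨x, h⟩ : Y) else y₀
  let T' : Y → X := fun y => if h : y ∈ Y.μ.support then (e.symm ⟨y, h⟩ : X) else x₀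
  have hT : ∀ x (h : x ∈ X.μ.support), T x = e ⟨x, h⟩ := fun x h => dif_pos h
  have hT' : ∀ y (h : y ∈ Y.μ.support), T' y = e.symm ⟨y, h⟩ := fun y h => dif_pos h
  have mT : Measurable T :=
    Measurable.dite (measurable_subtype_coe.comp e.continuous.measurable) measurable_const mX
  refine ⟨T, T', mT, ?_, ?_, ?_, ?_⟩
  · have h1 : X.μ = (X.μ.comap (Subtype.val : X.μ.support → X)).map Subtype.val := by
      rw [map_comap_subtype_coe mX]
      exact (Measure.restrict_eq_self_of_ae_mem Measure.support_mem_ae).symm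
    have h2 : Y.μ = (Y.μ.comap (Subtype.val : Y.μ.support → Y)).map Subtype.val := by
      rw [map_comap_subtype_coe mY]
      exact (Measure.restrict_eq_self_of_ae_mem Measure.support_mem_ae).symm
    rw [h2, ← he, Measure.map_map measurable_subtype_coe e.continuous.measurable]
    conv_lhs => rw [h1, Measure.map_map mT measurable_subtype_coe]
    congr 1
    ext x
    exact hT x.1 x.2
  · intro x hx
    rw [hT x hx]
    refine ⟨(e ⟨x, hx⟩).2, ?_⟩
    rw [hT' _ (e ⟨x, hx⟩).2]
    simp
  · intro x hx y hy
    rw [hT x hx, hT y hy, ← Subtype.edist_eq, e.edist_eq, Subtype.edist_eq]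
  · intro x hx y hy
    rw [hT' x hx, hT' y hy, ← Subtype.edist_eq, e.symm.edist_eq, Subtype.edist_eq]

/-- `1`-Lipschitz functions can be pulled back along a map that is isometric on a subset. -/
theorem exists_lipschitz_extension {X Y : Type u} [MetricSpace X] [MetricSpace Y] {T : X → Y}
    {S : Set X} (hT : ∀ x ∈ S, ∀ y ∈ S, edist (T x) (T y) = edist x y) {g : Y → ℝ}
    (hg : LipschitzWith 1 g) : ∃ f : X → ℝ, LipschitzWith 1 f ∧ ∀ x ∈ S, f x = g (T x) := by
  have : LipschitzOnWith 1 (g ∘ T) S := fun x hx y hy => by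
    rw [← hT x hx y hy]
    exact hg (T x) (T y)
  obtain ⟨f, hf, hfg⟩ := this.extend_real
  exact ⟨f, hf, fun x hx => (hfg hx).symm⟩

theorem MMIso.partialDiam_le {X Y : MMSpace.{u}} (h : MMIso X Y) (α : MultiIndex) :
    Y.partialDiam α ≤ X.partialDiam α := by
  obtain ⟨T, T', mT, hT, hTm, hTd, -⟩ := h.exists_maps
  refine le_iInf₂ fun Z hZ => le_iInf₂ fun A hA => ?_
  obtain ⟨F, hF, hFμ⟩ := hZ
  have cS : IsClosed (F ⁻¹' X.μ.support) := Measure.isClosed_support.preimage hF.continuous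
  have hS : ∀ᵐ z ∂Z.μ, z ∈ F ⁻¹' X.μ.support := by
    have h1 : ∀ᵐ x ∂(Z.μ.map F), x ∈ X.μ.support := by
      rw [hFμ]
      exact Measure.support_mem_ae
    exact ae_of_ae_map hF.continuous.measurable.aemeasurable h1
  have hmap : (Z.μ.comap (Subtype.val : F ⁻¹' X.μ.support → Z)).map Subtype.val = Z.μ := by
    rw [map_comap_subtype_coe cS.measurableSet]
    exact Measure.restrict_eq_self_of_ae_mem hS
  have : CompleteSpace (F ⁻¹' X.μ.support) := cS.completeSpace_coe
  have : IsProbabilityMeasure (Z.μ.comap (Subtype.val : F ⁻¹' X.μ.support → Z)) := by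
    constructor
    rw [← preimage_univ (f := (Subtype.val : F ⁻¹' X.μ.support → Z)),
      ← Measure.map_apply measurable_subtype_coe MeasurableSet.univ, hmap, measure_univ]
  let W : MMSpace.{u} :=
    { carrier := F ⁻¹' X.μ.support, μ := Z.μ.comap (Subtype.val : F ⁻¹' X.μ.support → Z) }
  have hW : W.Dominates Y := by
    refine ⟨fun z => T (F z.1), ?_, ?_⟩
    · intro z w
      rw [hTd _ z.2 _ w.2]
      exact hF z.1 w.1
    · have : (fun z : W => T (F z.1)) = (T ∘ F) ∘ Subtype.val := rfl
      rw [this]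
      change (Z.μ.comap (Subtype.val : F ⁻¹' X.μ.support → Z)).map ((T ∘ F) ∘ Subtype.val) = _
      rw [← Measure.map_map (mT.comp hF.continuous.measurable) measurable_subtype_coe, hmap,
        ← Measure.map_map mT hF.continuous.measurable, hFμ, hT]
  refine (iInf₂_le W hW).trans ?_
  let B : NatUpTo α.n → Set W := fun i => Subtype.val ⁻¹' (A i)
  have hB : B ∈ W.families α := by
    refine ⟨fun i => measurable_subtype_coe (hA.1 i), fun i j hij => (hA.2.1 hij).preimage _,
      fun i => ?_⟩
    refine (hA.2.2 i).trans_eq ?_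
    conv_lhs => rw [← hmap, Measure.map_apply measurable_subtype_coe (hA.1 i)]
  refine (iInf₂_le B hB).trans (iSup_mono fun i => ?_)
  exact Metric.ediam_le fun x hx y hy => Metric.edist_le_ediam_of_mem (s := A i) hx hy

theorem MMIso.obsDiam_le {X Y : MMSpace.{u}} (h : MMIso X Y) (α : MultiIndex) :
    Y.obsDiam α ≤ X.obsDiam α := by
  obtain ⟨T, T', mT, hT, hTm, hTd, -⟩ := h.exists_maps
  refine iSup₂_le fun g hg => ?_
  obtain ⟨f, hf, hfg⟩ := exists_lipschitz_extension hTd hg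
  have hfe : f =ᵐ[X.μ] g ∘ T := by
    filter_upwards [Measure.support_mem_ae (μ := X.μ)] with x hx using hfg x hx
  have hμ : X.μ.map f = Y.μ.map g := by
    rw [Measure.map_congr hfe, ← Measure.map_map hg.continuous.measurable mT, hT]
  have : Y.pushReal g hg = X.pushReal f hf := by
    simp only [pushReal, hμ]
  rw [this]
  exact le_iSup₂ (f := fun f hf => (X.pushReal f hf).partialDiam α) f hf

end MMSpace

theorem kyFan_congr {Ω : Type*} [MeasurableSpace Ω] {μ : Measure Ω} {f f' g g' : Ω → ℝ}
    (hf : f =ᵐ[μ] f') (hg : g =ᵐ[μ] g') : kyFan μ f g = kyFan μ f' g' := by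
  have : ∀ ε : ℝ≥0, μ {x | (ε : ℝ) < |f x - g x|} = μ {x | (ε : ℝ) < |f' x - g' x|} := by
    intro ε
    refine measure_congr ?_
    filter_upwards [hf, hg] with x h1 h2
    change ((ε : ℝ) < |f x - g x|) = ((ε : ℝ) < |f' x - g' x|)
    rw [h1, h2]
  simp only [kyFan, this]

theorem kyFanHausdorff_symm {Ω : Type*} [MeasurableSpace Ω] (μ : Measure Ω) (S T : Set (Ω → ℝ)) :
    kyFanHausdorff μ S T = kyFanHausdorff μ T S :=
  sup_comm _ _

theorem kyFanHausdorff_le_of_ae {Ω : Type*} [MeasurableSpace Ω] {μ : Measure Ω}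
    {S S' T : Set (Ω → ℝ)} (h : ∀ f ∈ S, ∃ f' ∈ S', f =ᵐ[μ] f')
    (h' : ∀ f' ∈ S', ∃ f ∈ S, f =ᵐ[μ] f') : kyFanHausdorff μ S' T ≤ kyFanHausdorff μ S T := by
  refine sup_le_sup (iSup₂_le fun f' hf' => ?_) (iSup₂_mono fun g _ => le_iInf₂ fun f hf => ?_)
  · obtain ⟨f, hf, hff⟩ := h' f' hf'
    refine le_trans ?_ (le_iSup₂ (f := fun f (_ : f ∈ S) => ⨅ g ∈ T, kyFan μ f g) f hf)
    exact iInf₂_mono fun g _ => (kyFan_congr hff.symm (ae_eq_refl g)).le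
  · obtain ⟨f', hf', hff⟩ := h f hf
    exact (iInf₂_le f' hf').trans (kyFan_congr (ae_eq_refl g) hff.symm).le

namespace MMSpace

theorem obsDist_symm (X Y : MMSpace.{u}) : obsDist X Y = obsDist Y X := by
  have key : ∀ X Y : MMSpace.{u}, obsDist X Y ≤ obsDist Y X := fun X Y =>
    le_iInf₂ fun ψ hψ => le_iInf₂ fun φ hφ =>
      (iInf₂_le φ hφ).trans ((iInf₂_le ψ hψ).trans (kyFanHausdorff_symm _ _ _).le)
  exact le_antisymm (key X Y) (key Y X)

theorem MMIso.obsDist_le {X X' : MMSpace.{u}} (h : MMIso X X') (Y : MMSpace.{u}) :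
    obsDist X' Y ≤ obsDist X Y := by
  obtain ⟨T, T', mT, hT, hTm, hTd, hTd'⟩ := h.exists_maps
  refine le_iInf₂ fun φ hφ => le_iInf₂ fun ψ hψ => ?_
  have hφ' : X'.IsParameter (T ∘ φ) :=
    ⟨mT.comp hφ.1, by rw [← Measure.map_map mT hφ.1, hφ.2, hT]⟩
  have hS : ∀ᵐ t ∂lebesgueI, φ t ∈ X.μ.support := by
    have h1 : ∀ᵐ x ∂(lebesgueI.map φ), x ∈ X.μ.support := by
      rw [hφ.2]
      exact Measure.support_mem_ae
    exact ae_of_ae_map hφ.1.aemeasurable h1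
  refine (iInf₂_le (T ∘ φ) hφ').trans ((iInf₂_le ψ hψ).trans (kyFanHausdorff_le_of_ae ?_ ?_))
  · rintro _ ⟨f, hf, rfl⟩
    obtain ⟨g, hg, hgf⟩ := exists_lipschitz_extension hTd' hf
    refine ⟨_, ⟨g, hg, rfl⟩, ?_⟩
    filter_upwards [hS] with t ht
    simp only [Function.comp_apply]
    rw [hgf _ (hTm _ ht).1, (hTm _ ht).2]
  · rintro _ ⟨g, hg, rfl⟩
    obtain ⟨f, hf, hfg⟩ := exists_lipschitz_extension hTd hg
    refine ⟨_, ⟨f, hf, rfl⟩, ?_⟩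
    filter_upwards [hS] with t ht
    exact hfg _ ht

instance mmSetoid : Setoid MMSpace.{u} where
  r := MMIso
  iseqv := ⟨MMIso.refl, MMIso.symm, MMIso.trans⟩

end MMSpace

/-- The set `𝒳` of mm-isomorphism classes of mm-spaces. -/
def MMClass : Type (u + 1) := Quotient MMSpace.mmSetoid.{u}

namespace MMClass

/-- The `α`-partial diameter of an mm-isomorphism class. -/
def partialDiam (α : MultiIndex) : MMClass.{u} → ℝ≥0∞ :=
  Quotient.lift (fun X => X.partialDiam α) fun _ _ h =>
    le_antisymm (h.symm.partialDiam_le α) (h.partialDiam_le α)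

/-- The `α`-observable diameter of an mm-isomorphism class. -/
def obsDiam (α : MultiIndex) : MMClass.{u} → ℝ≥0∞ :=
  Quotient.lift (fun X => X.obsDiam α) fun _ _ h =>
    le_antisymm (h.symm.obsDiam_le α) (h.obsDiam_le α)

/-- The observable distance on `𝒳`. -/
def obsDist : MMClass.{u} → MMClass.{u} → ℝ≥0∞ :=
  Quotient.lift₂ MMSpace.obsDist fun X Y X' Y' hX hY => by
    have key : ∀ {X X' Y Y' : MMSpace.{u}}, X.MMIso X' → Y.MMIso Y' →
        MMSpace.obsDist X' Y' ≤ MMSpace.obsDist X Y := fun {X X' Y Y'} hX hY => by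
      refine (hX.obsDist_le Y').trans ?_
      rw [MMSpace.obsDist_symm X Y', MMSpace.obsDist_symm X Y]
      exact hY.obsDist_le X
    exact le_antisymm (key hX.symm hY.symm) (key hX hY)

/-- The concentration topology: the topology on `𝒳` induced by the observable distance. A set is
open if and only if it contains a ball of positive radius around each of its points. -/
instance concentrationTopology : TopologicalSpace MMClass.{u} where
  IsOpen U := ∀ x ∈ U, ∃ ε : ℝ≥0∞, 0 < ε ∧ ∀ y, obsDist x y < ε → y ∈ U
  isOpen_univ := fun _ _ => ⟨1, one_pos, fun _ _ => trivial⟩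
  isOpen_inter := fun U V hU hV x hx => by
    obtain ⟨ε, hε, h1⟩ := hU x hx.1
    obtain ⟨δ, hδ, h2⟩ := hV x hx.2
    exact ⟨min ε δ, lt_min hε hδ, fun y hy =>
      ⟨h1 y (hy.trans_le (min_le_left _ _)), h2 y (hy.trans_le (min_le_right _ _))⟩⟩
  isOpen_sUnion := fun S hS x hx => by
    obtain ⟨U, hU, hxU⟩ := hx
    obtain ⟨ε, hε, h⟩ := hS U hU x hxU
    exact ⟨ε, hε, fun y hy => ⟨U, hU, h y hy⟩⟩

end MMClass

end

/-!
Up to an arbitrarily small loss, the partial diameter of `X` is at most `c` if and only if there are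
measures `ν i` with `∑ ν i ≤ μ_X`, total masses at least `α i` and supports of diameter at most `c`.
Pushing disjoint sets forward along a domination `Y ≻ X` gives such measures, and conversely the
`ν i` become disjointly supported once they are moved to different levels of `X × ℕ`.

Unlike families of disjoint sets, families of measures pass to the limit. If `Z k` converges to `X`,
with parameters `ψ k` and `φ k`, lift the measures on `Z k` along `ψ k` to `[0, 1)` and push them
forward along `φ k`. The resulting measures on `X` are dominated by `μ_X`, hence converge setwise
along an ultrafilter. To bound the distance of two points `x`, `y` in the support of a limit,
approximate `dist · x` by a `1`-Lipschitz function on `Z k`, whose oscillation on a set of diameter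
at most `c` is at most `c`. For the observable diameter, the same argument applies to the
push-forwards to `ℝ` under `1`-Lipschitz functions.
-/

open Filter Topology

section SetwiseLimit

variable {Ω κ ι : Type*} [MeasurableSpace Ω] {μ : Measure Ω} [IsFiniteMeasure μ]

theorem isSetRing_measurableSet : IsSetRing {s : Set Ω | MeasurableSet s} where
  empty_mem := MeasurableSet.empty
  union_mem _ _ := MeasurableSet.union
  sdiff_mem _ _ := MeasurableSet.diff

theorem exists_measure_eq_of_tendsto_of_le {L : Filter κ} [L.NeBot] {ν : κ → Measure Ω}
    (hν : ∀ k, ν k ≤ μ) {m : Set Ω → ℝ≥0∞}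
    (hm : ∀ s, MeasurableSet s → Tendsto (fun k => ν k s) L (𝓝 (m s))) :
    ∃ τ : Measure Ω, ∀ s, MeasurableSet s → τ s = m s := by
  have m_empty : m ∅ = 0 :=
    tendsto_nhds_unique (hm ∅ .empty) (by simpa only [measure_empty] using tendsto_const_nhds)
  have m_union {s t : Set Ω} (hs : MeasurableSet s) (ht : MeasurableSet t) (hst : Disjoint s t) :
      m (s ∪ t) = m s + m t :=
    tendsto_nhds_unique (hm _ (hs.union ht))
      (((hm s hs).add (hm t ht)).congr fun k => (measure_union hst ht).symm)
  have m_le (s : Set Ω) (hs : MeasurableSet s) : m s ≤ μ s :=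
    le_of_tendsto (hm s hs) (Eventually.of_forall fun k => hν k s)
  let content := isSetRing_measurableSet.addContent_of_union m m_empty m_union
  have content_tendsto_zero ⦃s : ℕ → Set Ω⦄ (hs : ∀ n, MeasurableSet (s n)) (s_anti : Antitone s)
      (s_inter : ⋂ n, s n = ∅) : Tendsto (fun n => content (s n)) atTop (𝓝 0) := by
    have μ_tendsto_zero : Tendsto (μ ∘ s) atTop (𝓝 0) := by
      simpa only [s_inter, measure_empty] using tendsto_measure_iInter_atTop
        (fun n => (hs n).nullMeasurableSet) s_anti ⟨0, measure_ne_top μ _⟩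
    exact tendsto_of_tendsto_of_tendsto_of_le_of_le tendsto_const_nhds μ_tendsto_zero
      (fun _ => zero_le) fun n => m_le _ (hs n)
  refine ⟨Measure.ofMeasurable (fun s _ => m s) m_empty fun f hf f_disj => ?_,
    fun s hs => Measure.ofMeasurable_apply s hs⟩
  exact addContent_iUnion_eq_sum_of_tendsto_zero isSetRing_measurableSet content
    (fun s hs => ((m_le s hs).trans_lt (measure_lt_top μ s)).ne) content_tendsto_zero hf
    (.iUnion hf) f_disj

theorem exists_tendsto_measure_of_le (U : Ultrafilter κ) {ν : κ → Measure Ω}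
    (hν : ∀ k, ν k ≤ μ) :
    ∃ τ : Measure Ω, ∀ s, MeasurableSet s → Tendsto (fun k => ν k s) U (𝓝 (τ s)) := by
  have hlim (s : Set Ω) : Tendsto (fun k => ν k s) U (𝓝 (U.map fun k => ν k s).lim) :=
    Ultrafilter.le_nhds_lim _
  obtain ⟨τ, hτ⟩ := exists_measure_eq_of_tendsto_of_le hν fun s _ => hlim s
  exact ⟨τ, fun s hs => hτ s hs ▸ hlim s⟩

theorem exists_sum_le_and_tendsto (U : Ultrafilter κ) {ν : κ → ι → Measure Ω}
    (hν : ∀ k, Measure.sum (ν k) ≤ μ) :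
    ∃ τ : ι → Measure Ω, Measure.sum τ ≤ μ ∧
      ∀ i s, MeasurableSet s → Tendsto (fun k => ν k i s) U (𝓝 (τ i s)) := by
  choose τ hτ using fun i =>
    exists_tendsto_measure_of_le U fun k => (Measure.le_sum (ν k) i).trans (hν k)
  refine ⟨τ, Measure.le_iff.2 fun s hs => ?_, hτ⟩
  rw [Measure.sum_apply _ hs, ENNReal.tsum_eq_iSup_sum]
  refine iSup_le fun F => le_of_tendsto (tendsto_finsetSum F fun i _ => hτ i s hs)
    (Eventually.of_forall fun k => ?_)
  calc ∑ i ∈ F, ν k i s ≤ ∑' i, ν k i s := ENNReal.sum_le_tsum F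
    _ = Measure.sum (ν k) s := (Measure.sum_apply _ hs).symm
    _ ≤ μ s := hν k s

end SetwiseLimit

section LiftMeasure

variable {Ω Y ι : Type*} [MeasurableSpace Ω] [MeasurableSpace Y] {P : Measure Ω} {Q ν : Measure Y}
  {ψ : Ω → Y}

/-- The lift along `ψ : Ω → Y` of a measure `ν` on `Y`, where `ψ` pushes `P` forward to `Q`: its
density with respect to `P` is the pullback of the density of `ν` with respect to `Q`. -/
noncomputable def liftMeasure (P : Measure Ω) (Q : Measure Y) (ψ : Ω → Y) (ν : Measure Y) :
    Measure Ω :=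
  P.withDensity (ν.rnDeriv Q ∘ ψ)

theorem map_liftMeasure [ν.HaveLebesgueDecomposition Q] (hψ : MeasurePreserving ψ P Q)
    (hν : ν ≪ Q) : (liftMeasure P Q ψ ν).map ψ = ν := by
  ext s hs
  rw [Measure.map_apply hψ.measurable hs, liftMeasure, withDensity_apply _ (hψ.measurable hs)]
  calc ∫⁻ t in ψ ⁻¹' s, ν.rnDeriv Q (ψ t) ∂P = ∫⁻ y in s, ν.rnDeriv Q y ∂Q :=
        hψ.setLIntegral_comp_preimage hs (Measure.measurable_rnDeriv ν Q)
    _ = ν s := by rw [← withDensity_apply _ hs, Measure.withDensity_rnDeriv_eq _ _ hν]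

theorem liftMeasure_le [SigmaFinite Q] (hψ : MeasurePreserving ψ P Q) (hν : ν ≤ Q) :
    liftMeasure P Q ψ ν ≤ P :=
  calc P.withDensity (ν.rnDeriv Q ∘ ψ) ≤ P.withDensity 1 :=
        withDensity_mono (hψ.quasiMeasurePreserving.ae (Measure.rnDeriv_le_one_of_le hν))
    _ = P := withDensity_one

theorem rnDeriv_sum [Countable ι] [SigmaFinite Q] {ν : ι → Measure Y}
    [∀ i, (ν i).HaveLebesgueDecomposition Q] (hν : ∀ i, ν i ≪ Q) :
    (Measure.sum ν).rnDeriv Q =ᵐ[Q] fun y => ∑' i, (ν i).rnDeriv Q y := by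
  have hdens : Q.withDensity (fun y => ∑' i, (ν i).rnDeriv Q y) = Measure.sum ν := by
    simp only [← tsum_apply (Pi.summable.2 fun _ => ENNReal.summable)]
    rw [withDensity_tsum fun i => Measure.measurable_rnDeriv (ν i) Q]
    exact congrArg Measure.sum (funext fun i => Measure.withDensity_rnDeriv_eq _ _ (hν i))
  rw [← hdens]
  exact Measure.rnDeriv_withDensity Q (Measurable.tsum fun i => Measure.measurable_rnDeriv (ν i) Q)

theorem sum_liftMeasure [Countable ι] [SigmaFinite Q] {ν : ι → Measure Y}
    [∀ i, (ν i).HaveLebesgueDecomposition Q] (hψ : MeasurePreserving ψ P Q) (hν : ∀ i, ν i ≪ Q) :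
    Measure.sum (fun i => liftMeasure P Q ψ (ν i)) = liftMeasure P Q ψ (Measure.sum ν) := by
  simp only [liftMeasure]
  rw [← withDensity_tsum fun i => (Measure.measurable_rnDeriv (ν i) Q).comp hψ.measurable]
  refine withDensity_congr_ae ?_
  filter_upwards [hψ.quasiMeasurePreserving.ae (rnDeriv_sum hν)] with t ht
  rw [tsum_apply (Pi.summable.2 fun _ => ENNReal.summable)]
  simp only [Function.comp_apply, ht]

theorem exists_sum_le_and_map_eq [Countable ι] [IsFiniteMeasure Q] {ν : ι → Measure Y}
    (hψ : MeasurePreserving ψ P Q) (hν : Measure.sum ν ≤ Q) :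
    ∃ ρ : ι → Measure Ω, Measure.sum ρ ≤ P ∧ ∀ i, (ρ i).map ψ = ν i := by
  have hle (i : ι) : ν i ≤ Q := (Measure.le_sum ν i).trans hν
  have hac (i : ι) : ν i ≪ Q := Measure.absolutelyContinuous_of_le (hle i)
  have hfin (i : ι) : IsFiniteMeasure (ν i) := isFiniteMeasure_of_le Q (hle i)
  refine ⟨fun i => liftMeasure P Q ψ (ν i), ?_, fun i => map_liftMeasure hψ (hac i)⟩
  rw [sum_liftMeasure hψ hac]
  exact liftMeasure_le hψ hν

end LiftMeasure

/-- A fractional version of a family `(A_i)` of disjoint sets with `μ(A_i) ≥ a_i` and diameters at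
most `c`: the restrictions `μ|A_i` are replaced by arbitrary measures `ν_i` with `∑ ν_i ≤ μ`. -/
structure IsFractionalFamily {X ι : Type*} [PseudoEMetricSpace X] [MeasurableSpace X]
    (μ : Measure X) (a : ι → ℝ≥0∞) (c : ℝ≥0∞) (ν : ι → Measure X) : Prop where
  sum_le : Measure.sum ν ≤ μ
  le_mass : ∀ i, a i ≤ ν i univ
  ediam_support_le : ∀ i, Metric.ediam (ν i).support ≤ c

section FractionalFamily

variable {X Y ι : Type*} [PseudoEMetricSpace X] [MeasurableSpace X] [PseudoEMetricSpace Y]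
  [MeasurableSpace Y] {μ : Measure X} {a : ι → ℝ≥0∞} {c : ℝ≥0∞}

theorem isFractionalFamily_restrict [OpensMeasurableSpace X] [Countable ι] {A : ι → Set X}
    (hA : ∀ i, MeasurableSet (A i)) (A_disj : Pairwise fun i j => Disjoint (A i) (A j))
    (hmass : ∀ i, a i ≤ μ (A i)) (hdiam : ∀ i, Metric.ediam (A i) ≤ c) :
    IsFractionalFamily μ a c fun i => μ.restrict (A i) where
  sum_le := (Measure.restrict_iUnion A_disj hA).symm.trans_le Measure.restrict_le_self
  le_mass i := by simpa only [Measure.restrict_apply_univ] using hmass i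
  ediam_support_le i :=
    calc Metric.ediam (μ.restrict (A i)).support ≤ Metric.ediam (closure (A i)) :=
          Metric.ediam_mono (Measure.support_restrict_subset.trans inter_subset_left)
      _ = Metric.ediam (A i) := Metric.ediam_closure _
      _ ≤ c := hdiam i

theorem support_map_subset_closure_image [HereditarilyLindelofSpace X] [OpensMeasurableSpace Y]
    {F : X → Y} (hF : Measurable F) :
    (μ.map F).support ⊆ closure (F '' μ.support) := by
  refine Measure.support_subset_of_isClosed isClosed_closure ?_
  refine (mem_ae_map_iff hF.aemeasurable isClosed_closure.measurableSet).2 ?_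
  filter_upwards [Measure.support_mem_ae (μ := μ)] with x hx
  exact subset_closure (mem_image_of_mem F hx)

theorem IsFractionalFamily.map [OpensMeasurableSpace X] [HereditarilyLindelofSpace X]
    [BorelSpace Y] {ν : ι → Measure X} (h : IsFractionalFamily μ a c ν) {F : X → Y}
    (hF : LipschitzWith 1 F) : IsFractionalFamily (μ.map F) a c fun i => (ν i).map F where
  sum_le := by
    rw [← Measure.map_sum hF.continuous.measurable.aemeasurable]
    exact Measure.map_mono h.sum_le hF.continuous.measurable
  le_mass i := by
    simpa only [Measure.map_apply hF.continuous.measurable .univ, preimage_univ] using h.le_mass i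
  ediam_support_le i :=
    calc Metric.ediam ((ν i).map F).support ≤ Metric.ediam (closure (F '' (ν i).support)) :=
          Metric.ediam_mono (support_map_subset_closure_image hF.continuous.measurable)
      _ = Metric.ediam (F '' (ν i).support) := Metric.ediam_closure _
      _ ≤ Metric.ediam (ν i).support := by
          simpa only [ENNReal.coe_one, one_mul] using hF.ediam_image_le (ν i).support
      _ ≤ c := h.ediam_support_le i

end FractionalFamily

section LabelledMeasure

variable {X L ι : Type*} [MeasurableSpace X] [MeasurableSpace L] {μ : Measure X}
  [IsFiniteMeasure μ] {ν : ι → Measure X} (l₀ : L) (l : ι → L)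

/-- The measure on `X × L` which splits `μ` into the measures `ν i`, moved to the levels `l i`, and
the remainder `μ - ∑ ν i`, moved to the level `l₀`. -/
noncomputable def labelledMeasure (μ : Measure X) (ν : ι → Measure X) (l₀ : L) (l : ι → L) :
    Measure (X × L) :=
  (μ - Measure.sum ν).prod (.dirac l₀) + Measure.sum fun i => (ν i).prod (.dirac (l i))

theorem fst_labelledMeasure (hν : Measure.sum ν ≤ μ) : (labelledMeasure μ ν l₀ l).fst = μ := by
  have : IsFiniteMeasure (Measure.sum ν) := isFiniteMeasure_of_le μ hν
  have (i : ι) : IsFiniteMeasure (ν i) :=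
    isFiniteMeasure_of_le μ ((Measure.le_sum ν i).trans hν)
  simp only [labelledMeasure, Measure.fst_add, Measure.fst_sum, Measure.fst_prod]
  exact Measure.sub_add_cancel_of_le hν

theorem le_labelledMeasure_prod_singleton [MeasurableSingletonClass L] (hν : Measure.sum ν ≤ μ)
    (i : ι) (s : Set X) : ν i s ≤ labelledMeasure μ ν l₀ l (s ×ˢ {l i}) := by
  have : IsFiniteMeasure (ν i) := isFiniteMeasure_of_le μ ((Measure.le_sum ν i).trans hν)
  calc ν i s = (ν i).prod (.dirac (l i)) (s ×ˢ {l i}) := by simp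
    _ ≤ Measure.sum (fun i => (ν i).prod (.dirac (l i))) (s ×ˢ {l i}) :=
        Measure.le_sum (fun i => (ν i).prod (.dirac (l i))) i _
    _ ≤ labelledMeasure μ ν l₀ l (s ×ˢ {l i}) := by
        rw [labelledMeasure, Measure.add_apply]
        exact le_add_self

end LabelledMeasure

section KyFan

variable {Ω : Type*} [MeasurableSpace Ω] {P ρ : Measure Ω} {f g : Ω → ℝ} {δ : ℝ≥0∞}

theorem measure_le_edist_lt_of_kyFan_lt (h : kyFan P f g < δ) :
    P {t | δ ≤ edist (f t) (g t)} < δ := by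
  simp only [kyFan, iInf_lt_iff] at h
  obtain ⟨ε, hPε, hεδ⟩ := h
  refine (measure_mono fun t ht => ?_).trans_lt (hPε.trans_lt hεδ)
  have hε : (ε : ℝ≥0∞) < edist (f t) (g t) := hεδ.trans_le ht
  rwa [edist_nndist, ENNReal.coe_lt_coe, ← NNReal.coe_lt_coe, coe_nndist, Real.dist_eq] at hε

theorem exists_mem_edist_lt_of_kyFan_lt (h : kyFan P f g < δ) (hρ : ρ ≤ P) {E : Set Ω}
    (hE : δ ≤ ρ E) {p : Ω → Prop} (hp : ∀ᵐ t ∂ρ, p t) :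
    ∃ t ∈ E, p t ∧ edist (f t) (g t) < δ := by
  by_contra! hfar
  have hsub : E ≤ᵐ[ρ] {t | δ ≤ edist (f t) (g t)} := by
    filter_upwards [hp] with t ht htE using hfar t htE ht
  exact ((measure_mono_ae hsub).trans (hρ _)).not_gt
    ((measure_le_edist_lt_of_kyFan_lt h).trans_le hE)

theorem kyFan_comp_le {h : ℝ → ℝ} (hh : LipschitzWith 1 h) :
    kyFan P (h ∘ f) (h ∘ g) ≤ kyFan P f g := by
  refine le_iInf₂ fun ε hε => iInf₂_le ε ((measure_mono fun t ht => ?_).trans hε)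
  have hfg : |h (f t) - h (g t)| ≤ |f t - g t| := by
    simpa only [Real.dist_eq, NNReal.coe_one, one_mul] using hh.dist_le_mul (f t) (g t)
  exact lt_of_lt_of_le (mem_ofPred.1 ht) hfg

end KyFan

/-- Every function in `φ^* Lip_1(X)` is at Ky Fan distance less than `δ` from `ψ^* Lip_1(Z)`: the
one-sided half of the Hausdorff distance which defines the observable distance. -/
def LipschitzApprox {Ω X Z : Type*} [MeasurableSpace Ω] [PseudoEMetricSpace X]
    [PseudoEMetricSpace Z] (P : Measure Ω) (φ : Ω → X) (ψ : Ω → Z) (δ : ℝ≥0∞) : Prop :=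
  ∀ f : X → ℝ, LipschitzWith 1 f →
    ∃ g : Z → ℝ, LipschitzWith 1 g ∧ kyFan P (f ∘ φ) (g ∘ ψ) < δ

theorem lipschitzApprox_of_kyFan_lt {Ω : Type*} [MeasurableSpace Ω] {P : Measure Ω} {f g : Ω → ℝ}
    {δ : ℝ≥0∞} (h : kyFan P f g < δ) : LipschitzApprox P f g δ :=
  fun e he => ⟨e, he, (kyFan_comp_le he).trans_lt h⟩

section Limit

variable {Ω X : Type*} [MeasurableSpace Ω] [PseudoMetricSpace X] {P : Measure Ω}

theorem LipschitzApprox.edist_le {Z : Type*} [PseudoEMetricSpace Z] {φ : Ω → X} {ψ : Ω → Z}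
    {δ : ℝ≥0∞} (h : LipschitzApprox P φ ψ δ) {ρ : Measure Ω} (hρ : ρ ≤ P) {T : Set Z}
    (hT : ∀ᵐ t ∂ρ, ψ t ∈ T) {x y : X} {r : ℝ≥0∞} (hx : δ ≤ ρ (φ ⁻¹' Metric.eball x r))
    (hy : δ ≤ ρ (φ ⁻¹' Metric.eball y r)) :
    edist x y ≤ Metric.ediam T + 2 * (δ + r) := by
  -- Testing against `f = dist · x` turns distances to `x` into differences of values of `f`.
  let f : X → ℝ := fun z => dist z x
  have hf : LipschitzWith 1 f := LipschitzWith.dist_left x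
  have hf' (z w : X) : edist (f z) (f w) ≤ edist z w := by
    simpa only [ENNReal.coe_one, one_mul] using hf z w
  obtain ⟨g, hg, hfg⟩ := h f hf
  obtain ⟨s, hsx, hsT, hs⟩ := exists_mem_edist_lt_of_kyFan_lt hfg hρ hx hT
  obtain ⟨t, hty, htT, ht⟩ := exists_mem_edist_lt_of_kyFan_lt hfg hρ hy hT
  have hgst : edist (g (ψ s)) (g (ψ t)) ≤ Metric.ediam T := by
    refine le_trans ?_ (Metric.edist_le_ediam_of_mem hsT htT)
    simpa only [ENNReal.coe_one, one_mul] using hg (ψ s) (ψ t)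
  have hfst : edist (f (φ s)) (f (φ t)) ≤ δ + Metric.ediam T + δ := by
    refine (edist_triangle4 _ (g (ψ s)) (g (ψ t)) _).trans ?_
    rw [edist_comm (g (ψ t))]
    exact add_le_add_three hs.le hgst ht.le
  have hsr : edist x (φ s) ≤ r := by simpa only [edist_comm] using (Metric.mem_eball.1 hsx).le
  have htr : edist (φ t) y ≤ r := (Metric.mem_eball.1 hty).le
  calc edist x y = edist (f x) (f y) := by simp [f, edist_dist, dist_comm y x]
    _ ≤ edist (f x) (f (φ s)) + edist (f (φ s)) (f (φ t)) + edist (f (φ t)) (f y) :=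
        edist_triangle4 _ _ _ _
    _ ≤ r + (δ + Metric.ediam T + δ) + r :=
        add_le_add_three ((hf' _ _).trans hsr) hfst ((hf' _ _).trans htr)
    _ = Metric.ediam T + 2 * (δ + r) := by ring

variable {κ : Type*} {Z : κ → Type*} [∀ k, PseudoEMetricSpace (Z k)] {φ : κ → Ω → X}
  {ψ : ∀ k, Ω → Z k} {L : Filter κ} [L.NeBot] {δ : κ → ℝ≥0∞} {c : ℝ≥0∞}

theorem ediam_support_le_of_lipschitzApprox [MeasurableSpace X] (hδ : Tendsto δ L (𝓝 0))
    (happrox : ∀ k, LipschitzApprox P (φ k) (ψ k) (δ k)) {ρ : κ → Measure Ω} (hρ : ∀ k, ρ k ≤ P)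
    {T : ∀ k, Set (Z k)} (hT : ∀ k, ∀ᵐ t ∂ρ k, ψ k t ∈ T k) (hTc : ∀ k, Metric.ediam (T k) ≤ c)
    {τ : Measure X}
    (hτ : ∀ s, IsOpen s → Tendsto (fun k => ρ k (φ k ⁻¹' s)) L (𝓝 (τ s))) :
    Metric.ediam τ.support ≤ c := by
  refine Metric.ediam_le fun x hx y hy => ?_
  have hlarge {z : X} (hz : z ∈ τ.support) {r : ℝ≥0∞} (hr : 0 < r) :
      ∀ᶠ k in L, δ k < ρ k (φ k ⁻¹' Metric.eball z r) :=
    hδ.eventually_lt (hτ _ Metric.isOpen_eball)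
      ((Measure.mem_support_iff_forall z).1 hz _ (Metric.eball_mem_nhds z hr))
  have hbound (r : ℝ≥0∞) (hr : 0 < r) : edist x y ≤ c + 2 * (0 + r) := by
    have hlim : Tendsto (fun k => c + 2 * (δ k + r)) L (𝓝 (c + 2 * (0 + r))) :=
      tendsto_const_nhds.add
        (ENNReal.Tendsto.const_mul (hδ.add tendsto_const_nhds) (.inr ENNReal.ofNat_ne_top))
    refine ge_of_tendsto hlim ?_
    filter_upwards [hlarge hx hr, hlarge hy hr] with k hkx hky
    exact ((happrox k).edist_le (hρ k) (hT k) hkx.le hky.le).trans (by gcongr; exact hTc k)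
  have hlim : Tendsto (fun r : ℝ≥0∞ => c + 2 * (0 + r)) (𝓝[>] 0) (𝓝 (c + 2 * (0 + 0))) :=
    (by fun_prop (disch := simp) : Continuous fun r : ℝ≥0∞ => c + 2 * (0 + r)).continuousWithinAt
  simpa using ge_of_tendsto hlim (eventually_mem_nhdsWithin.mono hbound)

theorem exists_isFractionalFamily_of_lipschitzApprox {ι : Type*} [Countable ι] {a : ι → ℝ≥0∞}
    [MeasurableSpace X] [OpensMeasurableSpace X] [∀ k, MeasurableSpace (Z k)]
    [∀ k, HereditarilyLindelofSpace (Z k)] {μ : Measure X} [IsFiniteMeasure μ]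
    {μZ : ∀ k, Measure (Z k)} [∀ k, IsFiniteMeasure (μZ k)]
    (hφ : ∀ k, MeasurePreserving (φ k) P μ) (hψ : ∀ k, MeasurePreserving (ψ k) P (μZ k))
    (hδ : Tendsto δ L (𝓝 0)) (happrox : ∀ k, LipschitzApprox P (φ k) (ψ k) (δ k))
    (h : ∀ k, ∃ ν, IsFractionalFamily (μZ k) a c ν) : ∃ τ, IsFractionalFamily μ a c τ := by
  choose ν hν using h
  choose ρ hρ hρν using fun k => exists_sum_le_and_map_eq (hψ k) (hν k).sum_le
  have hσ (k : κ) : Measure.sum (fun i => (ρ k i).map (φ k)) ≤ μ := by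
    rw [← Measure.map_sum (hφ k).measurable.aemeasurable, ← (hφ k).map_eq]
    exact Measure.map_mono (hρ k) (hφ k).measurable
  obtain ⟨τ, hτ, hτlim⟩ := exists_sum_le_and_tendsto (Ultrafilter.of L) hσ
  have hmass (k : κ) (i : ι) : a i ≤ (ρ k i).map (φ k) univ := by
    have := (hν k).le_mass i
    rwa [← hρν, Measure.map_apply (hψ k).measurable .univ, preimage_univ,
      ← preimage_univ (f := φ k), ← Measure.map_apply (hφ k).measurable .univ] at this
  have hsupp (k : κ) (i : ι) : ∀ᵐ t ∂ρ k i, ψ k t ∈ (ν k i).support := by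
    refine ae_of_ae_map (hψ k).measurable.aemeasurable ?_
    rw [hρν]
    exact Measure.support_mem_ae
  refine ⟨τ, hτ, fun i => ?_, fun i => ?_⟩
  · exact ge_of_tendsto (hτlim i univ .univ) (Eventually.of_forall fun k => hmass k i)
  · refine ediam_support_le_of_lipschitzApprox (hδ.mono_left (Ultrafilter.of_le L)) happrox
      (fun k => (Measure.le_sum (ρ k) i).trans (hρ k)) (fun k => hsupp k i)
      (fun k => (hν k).ediam_support_le i) fun s hs => ?_
    exact (hτlim i s hs.measurableSet).congr fun k =>
      Measure.map_apply (hφ k).measurable hs.measurableSet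

end Limit

namespace MMSpace

variable {X : MMSpace.{u}} {α : MultiIndex} {c : ℝ≥0∞}

theorem exists_isFractionalFamily_of_partialDiam_lt (h : X.partialDiam α < c) :
    ∃ ν, IsFractionalFamily X.μ (fun i => ENNReal.ofReal (α.val i)) c ν := by
  simp only [partialDiam, diam, iInf_lt_iff] at h
  obtain ⟨Y, ⟨F, hF, hFμ⟩, A, ⟨hA, A_disj, hmass⟩, hc⟩ := h
  have hν := isFractionalFamily_restrict hA A_disj hmass fun i =>
    (le_iSup (fun i => Metric.ediam (A i)) i).trans hc.le
  exact ⟨_, hFμ ▸ hν.map hF⟩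

theorem partialDiam_le_of_isFractionalFamily {ν : NatUpTo α.n → Measure X}
    (h : IsFractionalFamily X.μ (fun i => ENNReal.ofReal (α.val i)) c ν) :
    X.partialDiam α ≤ c := by
  let M : Measure (X × ℕ) := labelledMeasure X.μ ν 0 Subtype.val
  have hM : M.fst = X.μ := fst_labelledMeasure 0 Subtype.val h.sum_le
  have : IsProbabilityMeasure M := ⟨by rw [← Measure.fst_univ, hM, measure_univ]⟩
  let Y : MMSpace.{u} := { carrier := X × ℕ, μ := M }
  let A (i : NatUpTo α.n) : Set Y := (ν i).support ×ˢ {(i : ℕ)}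
  have hA : A ∈ Y.families α := by
    refine ⟨fun i => Measure.isClosed_support.measurableSet.prod (measurableSet_singleton _),
      fun i j hij => ?_, fun i => ?_⟩
    · exact disjoint_prod.2 (.inr (disjoint_singleton.2 (Subtype.coe_ne_coe.2 hij)))
    · calc ENNReal.ofReal (α.val i) ≤ ν i univ := h.le_mass i
        _ = ν i (ν i).support := (measure_congr (eventuallyEq_univ.2 Measure.support_mem_ae)).symm
        _ ≤ M (A i) := le_labelledMeasure_prod_singleton 0 Subtype.val h.sum_le i _
  have hdiam (i : NatUpTo α.n) : Metric.ediam (A i) ≤ c := by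
    refine Metric.ediam_le fun p hp q hq => max_le ?_ ?_
    · exact (Metric.edist_le_ediam_of_mem hp.1 hq.1).trans (h.ediam_support_le i)
    · exact (edist_eq_zero.2 (hp.2.trans hq.2.symm)).trans_le zero_le
  calc X.partialDiam α ≤ Y.diam α := iInf₂_le Y ⟨Prod.fst, LipschitzWith.prod_fst, hM⟩
    _ ≤ ⨆ i, Metric.ediam (A i) := iInf₂_le A hA
    _ ≤ c := iSup_le hdiam

section Limit

variable {κ : Type*} {L : Filter κ} [L.NeBot] {δ : κ → ℝ≥0∞}

theorem partialDiam_le_of_lipschitzApprox {Z : κ → MMSpace} {Ω : Type*} [MeasurableSpace Ω]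
    {P : Measure Ω} {φ : κ → Ω → X} {ψ : ∀ k, Ω → Z k}
    (hφ : ∀ k, MeasurePreserving (φ k) P X.μ) (hψ : ∀ k, MeasurePreserving (ψ k) P (Z k).μ)
    (hδ : Tendsto δ L (𝓝 0)) (happrox : ∀ k, LipschitzApprox P (φ k) (ψ k) (δ k))
    (hc : ∀ k, (Z k).partialDiam α ≤ c) : X.partialDiam α ≤ c := by
  refine le_of_forall_gt_imp_ge_of_dense fun c' hc' => ?_
  obtain ⟨τ, hτ⟩ := exists_isFractionalFamily_of_lipschitzApprox hφ hψ hδ happrox fun k =>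
    exists_isFractionalFamily_of_partialDiam_lt ((hc k).trans_lt hc')
  exact partialDiam_le_of_isFractionalFamily hτ

theorem exists_lipschitzApprox_of_obsDist_lt {Y : MMSpace.{u}} {δ : ℝ≥0∞}
    (h : X.obsDist Y < δ) :
    ∃ (φ : Ico (0 : ℝ) 1 → X) (ψ : Ico (0 : ℝ) 1 → Y), MeasurePreserving φ lebesgueI X.μ ∧
      MeasurePreserving ψ lebesgueI Y.μ ∧ LipschitzApprox lebesgueI φ ψ δ := by
  simp only [obsDist, iInf_lt_iff] at h
  obtain ⟨φ, hφ, ψ, hψ, hdist⟩ := h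
  refine ⟨φ, ψ, ⟨hφ.1, hφ.2⟩, ⟨hψ.1, hψ.2⟩, fun f hf => ?_⟩
  have hinf : ⨅ g ∈ Y.pullLip ψ, kyFan lebesgueI (f ∘ φ) g < δ :=
    (le_iSup₂ (f := fun f (_ : f ∈ X.pullLip φ) => ⨅ g ∈ Y.pullLip ψ, kyFan lebesgueI f g)
      (f ∘ φ) ⟨f, hf, rfl⟩).trans_lt (le_sup_left.trans_lt hdist)
  simp only [iInf_lt_iff] at hinf
  obtain ⟨_, ⟨g, hg, rfl⟩, hfg⟩ := hinf
  exact ⟨g, hg, hfg⟩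

variable {Z : κ → MMSpace.{u}}

theorem partialDiam_le_of_obsDist_lt (hδ : Tendsto δ L (𝓝 0)) (hZ : ∀ k, X.obsDist (Z k) < δ k)
    (hc : ∀ k, (Z k).partialDiam α ≤ c) : X.partialDiam α ≤ c := by
  choose φ ψ hφ hψ happrox using fun k => exists_lipschitzApprox_of_obsDist_lt (hZ k)
  exact partialDiam_le_of_lipschitzApprox hφ hψ hδ happrox hc

theorem measurePreserving_pushReal {f : X → ℝ} (hf : LipschitzWith 1 f) :
    MeasurePreserving f X.μ (X.pushReal f hf).μ :=
  ⟨hf.continuous.measurable, rfl⟩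

theorem obsDiam_le_of_obsDist_lt (hδ : Tendsto δ L (𝓝 0)) (hZ : ∀ k, X.obsDist (Z k) < δ k)
    (hc : ∀ k, (Z k).obsDiam α ≤ c) : X.obsDiam α ≤ c := by
  refine iSup₂_le fun f hf => ?_
  choose φ ψ hφ hψ happrox using fun k => exists_lipschitzApprox_of_obsDist_lt (hZ k)
  choose g hg hfg using fun k => happrox k f hf
  have hgc (k : κ) : ((Z k).pushReal (g k) (hg k)).partialDiam α ≤ c :=
    (le_iSup₂ (f := fun g hg => ((Z k).pushReal g hg).partialDiam α) (g k) (hg k)).trans (hc k)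
  exact partialDiam_le_of_lipschitzApprox (fun k => (measurePreserving_pushReal hf).comp (hφ k))
    (fun k => (measurePreserving_pushReal (hg k)).comp (hψ k)) hδ
    (fun k => lipschitzApprox_of_kyFan_lt (hfg k)) hgc

end Limit

end MMSpace

theorem MMClass.lowerSemicontinuous_of_seq {β : Type*} [LinearOrder β] {F : MMClass.{u} → β}
    (h : ∀ (X : MMSpace.{u}) (Z : ℕ → MMSpace.{u}) (δ : ℕ → ℝ≥0∞) (c : β),
      Tendsto δ atTop (𝓝 0) → (∀ k, X.obsDist (Z k) < δ k) →
        (∀ k, F ⟦Z k⟧ ≤ c) → F ⟦X⟧ ≤ c) :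
    LowerSemicontinuous F := by
  refine lowerSemicontinuous_iff_isOpen_preimage.2 fun c x hx => ?_
  obtain ⟨X, rfl⟩ := Quotient.exists_rep x
  by_contra! hball
  obtain ⟨δ, -, hδ_mem, hδ⟩ := exists_seq_strictAnti_tendsto' (zero_lt_one' ℝ≥0∞)
  choose z hz hzc using fun k => hball (δ k) (hδ_mem k).1
  choose Z hZ using fun k => Quotient.exists_rep (z k)
  obtain rfl : (fun k => ⟦Z k⟧) = z := funext hZ
  exact (h X Z δ c hδ hz fun k => not_lt.1 (hzc k)).not_gt hx

theorem mainTheorem7 (α : MultiIndex) :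
    LowerSemicontinuous (MMClass.partialDiam α : MMClass.{u} → ENNReal) ∧
      LowerSemicontinuous (MMClass.obsDiam α : MMClass.{u} → ENNReal) := by
  constructor
  · exact MMClass.lowerSemicontinuous_of_seq fun _ _ _ _ hδ hZ hc =>
      MMSpace.partialDiam_le_of_obsDist_lt hδ hZ hc
  · exact MMClass.lowerSemicontinuous_of_seq fun _ _ _ _ hδ hZ hc =>
      MMSpace.obsDiam_le_of_obsDist_lt hδ hZ hc
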